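/- Let $M$ be a smooth $2$-manifold, let $(N,g)$ be a smooth Riemannian $3$-manifold, and let $f\colon M\to N$ be a $C^\infty$-map that has a cross cap at $p\in M$; that is, there are smooth local coordinates $\varphi=(u,v)$ of $M$ centered at $p$ and $\psi$ of $N$ centered at $f(p)$ such that $\psi\circ f\circ\varphi^{-1}(u,v)=(u,uv,v^2)$ near the origin. Call $q\in M$ an umbilical point of $f$ if $f$ is an immersion at $q$ and the second fundamental form of $f$ at $q$ (with respect to a unit normal vector and the Levi-Civita connection of $g$) is a scalar multiple of the first fundamental form at $q$. Then the umbilical points of $f$ do not accumulate at $p$: there is a neighborhood $W$ of $p$ such that no point of $W\setminus\{p\}$ is an umbilical point of $f$. -/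

import Mathlib

open scoped Manifold ContDiff Topology

noncomputable section

namespace CrossCap

/-- The coordinate plane. -/
abbrev E2 : Type := EuclideanSpace ℝ (Fin 2)

/-- The coordinate 3-space. -/
abbrev E3 : Type := EuclideanSpace ℝ (Fin 3)

/-- The standard cross cap `(u, v) ↦ (u, u v, v²)`. -/
def std (x : E2) : E3 := !₂[x 0, x 0 * x 1, x 1 ^ 2]

section Maps

variable {M : Type*} [TopologicalSpace M] [ChartedSpace E2 M]
  {N : Type*} [TopologicalSpace N] [ChartedSpace E3 N]

/-- `f` has a cross cap (Whitney umbrella) at `p`: there are smooth local coordinates `φ` of the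
surface centred at `p` and `ψ` of the 3-manifold centred at `f p` such that `ψ ∘ f = std ∘ φ`
near `p`. -/
def IsCrossCapAt (f : M → N) (p : M) : Prop :=
  ∃ φ ∈ IsManifold.maximalAtlas (𝓡 2) ∞ M, ∃ ψ ∈ IsManifold.maximalAtlas (𝓡 3) ∞ N,
    p ∈ φ.source ∧ φ p = 0 ∧ f p ∈ ψ.source ∧ ψ (f p) = 0 ∧
    ∀ᶠ q in 𝓝 p, ψ (f q) = std (φ q)

/-- The expression `ψ ∘ f ∘ φ⁻¹` of `f` in local coordinates. -/
def localMap (φ : OpenPartialHomeomorph M E2) (ψ : OpenPartialHomeomorph N E3) (f : M → N) :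
    E2 → E3 :=
  fun x => ψ (f (φ.symm x))

variable [IsManifold (𝓡 3) ∞ N]

/-- A smooth Riemannian metric on the 3-manifold `N`. -/
abbrev Metric (N : Type*) [TopologicalSpace N] [ChartedSpace E3 N] [IsManifold (𝓡 3) ∞ N] :
    Type _ :=
  Bundle.ContMDiffRiemannianMetric (𝓡 3) ∞ E3 (fun x : N => TangentSpace (𝓡 3) x)

/-- The metric `g` in the coordinates `ψ`: the pull-back of `g` by `ψ⁻¹`, evaluated at the
coordinate point `y` on the vectors `a`, `b`. -/
def localMetric (g : Metric N) (ψ : OpenPartialHomeomorph N E3) (y a b : E3) : ℝ :=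
  g.inner (ψ.symm y) (mfderiv (𝓡 3) (𝓡 3) ψ.symm y a) (mfderiv (𝓡 3) (𝓡 3) ψ.symm y b)

/-- The Christoffel symbols of the first kind of the Levi-Civita connection `D` of `g` in the
coordinates `ψ`, as a trilinear form: `g (D_a b, c)` for the constant coordinate fields
`a`, `b`, `c`. -/
def christoffel (g : Metric N) (ψ : OpenPartialHomeomorph N E3) (y a b c : E3) : ℝ :=
  (fderiv ℝ (fun z => localMetric g ψ z b c) y a
    + fderiv ℝ (fun z => localMetric g ψ z a c) y b
    - fderiv ℝ (fun z => localMetric g ψ z a b) y c) / 2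

/-- The first fundamental form of `f` in the coordinates `φ`, `ψ`, at the coordinate point `x`. -/
def firstForm (g : Metric N) (φ : OpenPartialHomeomorph M E2) (ψ : OpenPartialHomeomorph N E3)
    (f : M → N) (x X Y : E2) : ℝ :=
  localMetric g ψ (localMap φ ψ f x) (fderiv ℝ (localMap φ ψ f) x X)
    (fderiv ℝ (localMap φ ψ f) x Y)

/-- The second fundamental form `g (D_X (df Y), ν)` of `f` with respect to the normal vector `ν`,
in the coordinates `φ`, `ψ`, at the coordinate point `x`. Here `X`, `Y` are constant coordinate
fields and `D` is the Levi-Civita connection of `g` along `f`. -/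
def secondForm (g : Metric N) (φ : OpenPartialHomeomorph M E2) (ψ : OpenPartialHomeomorph N E3)
    (f : M → N) (x : E2) (ν : E3) (X Y : E2) : ℝ :=
  localMetric g ψ (localMap φ ψ f x) (fderiv ℝ (fderiv ℝ (localMap φ ψ f)) x X Y) ν
    + christoffel g ψ (localMap φ ψ f x) (fderiv ℝ (localMap φ ψ f) x X)
        (fderiv ℝ (localMap φ ψ f) x Y) ν

/-- `ν` is a unit normal vector of `f` at the coordinate point `x`. -/
def IsUnitNormal (g : Metric N) (φ : OpenPartialHomeomorph M E2) (ψ : OpenPartialHomeomorph N E3)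
    (f : M → N) (x : E2) (ν : E3) : Prop :=
  localMetric g ψ (localMap φ ψ f x) ν ν = 1 ∧
    ∀ X : E2, localMetric g ψ (localMap φ ψ f x) (fderiv ℝ (localMap φ ψ f) x X) ν = 0

/-- `q` is an umbilical point of `f`: `f` is an immersion at `q` and, in local coordinates, the
second fundamental form at `q` is a multiple of the first one, that is, the shape operator is a
multiple of the identity. Both forms are tensors, so the condition is the same in all smooth
coordinates `φ` around `q` and `ψ` around `f q`. -/
def IsUmbilicalPoint (g : Metric N) (f : M → N) (q : M) : Prop :=
  Function.Injective (mfderiv (𝓡 2) (𝓡 3) f q) ∧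
  ∀ φ ∈ IsManifold.maximalAtlas (𝓡 2) ∞ M, ∀ ψ ∈ IsManifold.maximalAtlas (𝓡 3) ∞ N,
    q ∈ φ.source → f q ∈ ψ.source →
    ∃ ν : E3, IsUnitNormal g φ ψ f (φ q) ν ∧
      ∃ c : ℝ, ∀ X Y : E2, secondForm g φ ψ f (φ q) ν X Y = c * firstForm g φ ψ f (φ q) X Y

end Maps

end CrossCap

end

/-!
At a regular point, being umbilical with normal `ν` means that the quadratic forms `II_ν` and `I`
satisfy `II_ν(X, Y) I(Z, W) = II_ν(Z, W) I(X, Y)`. Together with the normality of `ν` this is a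
closed condition on the point and the vector `ν`, homogeneous in `ν`, and it makes sense at the
singular point too. Since the unit sphere is compact, if no `ν ≠ 0` satisfies it at `p`, then none
does near `p`. At a cross cap, let `v` span the kernel of `df` and choose `u` with `df(u) ≠ 0`.
Then `I(X, v) = 0` for every `X` while `I(u, u) ≠ 0`, so `II_ν(X, v) = g(d²f(X, v), ν)` vanishes.
The vectors `df(X)` and `d²f(Y, v)` span the tangent space of `N`, hence `ν = 0`.
-/

noncomputable section

namespace CrossCap

section Hypersurface

variable {E V : Type*} [NormedAddCommGroup E] [NormedSpace ℝ E]
  [NormedAddCommGroup V] [NormedSpace ℝ V]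
  {G : V → V →L[ℝ] V →L[ℝ] ℝ} {F F' : E → V} {x : E} {ν : V}

/-- The Christoffel symbols of the first kind of a field `G` of bilinear forms on a normed space,
as a trilinear form. -/
def christoffelForm (G : V → V →L[ℝ] V →L[ℝ] ℝ) (y a b c : V) : ℝ :=
  (fderiv ℝ G y a b c + fderiv ℝ G y b a c - fderiv ℝ G y c a b) / 2

/-- The first fundamental form at `x` of a map `F` into a normed space with metric `G`. -/
def firstFundamentalForm (G : V → V →L[ℝ] V →L[ℝ] ℝ) (F : E → V) (x X Y : E) : ℝ :=
  G (F x) (fderiv ℝ F x X) (fderiv ℝ F x Y)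

/-- The second fundamental form at `x`, in the direction `ν`, of a map `F` into a normed space with
metric `G`. It is defined for every vector `ν`, normal or not, and is linear in `ν`. -/
def secondFundamentalForm (G : V → V →L[ℝ] V →L[ℝ] ℝ) (F : E → V) (x : E) (ν : V) (X Y : E) : ℝ :=
  G (F x) (fderiv ℝ (fderiv ℝ F) x X Y) ν
    + christoffelForm G (F x) (fderiv ℝ F x X) (fderiv ℝ F x Y) ν

/-- `ν` is a normal vector of `F` at `x` in whose direction the second fundamental form is
proportional to the first one. Cross-multiplying the proportionality eliminates the factor; the
condition is then closed in `(x, ν)`, homogeneous in `ν`, and still restrictive at singular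
points of `F` where the first fundamental form is nonzero. -/
def IsUmbilicalNormal (G : V → V →L[ℝ] V →L[ℝ] ℝ) (F : E → V) (x : E) (ν : V) : Prop :=
  (∀ X, G (F x) (fderiv ℝ F x X) ν = 0) ∧
    ∀ X Y Z W, secondFundamentalForm G F x ν X Y * firstFundamentalForm G F x Z W =
      secondFundamentalForm G F x ν Z W * firstFundamentalForm G F x X Y

lemma secondFundamentalForm_smul (t : ℝ) (X Y : E) :
    secondFundamentalForm G F x (t • ν) X Y = t * secondFundamentalForm G F x ν X Y := by
  simp only [secondFundamentalForm, christoffelForm, map_smul, smul_apply, smul_eq_mul]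
  ring

lemma IsUmbilicalNormal.smul (h : IsUmbilicalNormal G F x ν) (t : ℝ) :
    IsUmbilicalNormal G F x (t • ν) := by
  refine ⟨fun X => by rw [map_smul, h.1, smul_zero], fun X Y Z W => ?_⟩
  rw [secondFundamentalForm_smul, secondFundamentalForm_smul, mul_assoc, h.2, mul_assoc]

lemma isUmbilicalNormal_congr (h : F =ᶠ[𝓝 x] F') :
    IsUmbilicalNormal G F x ν ↔ IsUmbilicalNormal G F' x ν := by
  simp only [IsUmbilicalNormal, firstFundamentalForm, secondFundamentalForm, h.eq_of_nhds,
    h.fderiv_eq, h.fderiv.fderiv_eq]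

lemma continuousAt_firstFundamentalForm (hG : ContinuousAt G (F x)) (hF : ContDiffAt ℝ 1 F x)
    (X Y : E) : ContinuousAt (fun z => firstFundamentalForm G F z X Y) x := by
  have hG₀ : ContinuousAt (fun z => G (F z)) x := ContinuousAt.comp' hG hF.continuousAt
  have hF₁ (X : E) : ContinuousAt (fun z => fderiv ℝ F z X) x :=
    (hF.continuousAt_fderiv one_ne_zero).clm_apply continuousAt_const
  exact (hG₀.clm_apply (hF₁ X)).clm_apply (hF₁ Y)

set_option maxSynthPendingDepth 2 in
lemma continuousAt_secondFundamentalForm (hG : ContDiffAt ℝ 1 G (F x)) (hF : ContDiffAt ℝ 2 F x)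
    (ν : V) (X Y : E) :
    ContinuousAt (fun z : E × V => secondFundamentalForm G F z.1 z.2 X Y) (x, ν) := by
  have hF' : ContDiffAt ℝ 1 (fderiv ℝ F) x := hF.fderiv_right le_rfl
  have hF₁ (X : E) : ContinuousAt (fun z : E × V => fderiv ℝ F z.1 X) (x, ν) :=
    hF'.continuousAt.fst'.clm_apply continuousAt_const
  have hF₂ : ContinuousAt (fun z : E × V => fderiv ℝ (fderiv ℝ F) z.1 X Y) (x, ν) :=
    ((hF'.continuousAt_fderiv one_ne_zero).fst'.clm_apply continuousAt_const).clm_apply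
      continuousAt_const
  have hG₀ : ContinuousAt (fun z : E × V => G (F z.1)) (x, ν) :=
    (ContinuousAt.comp' hG.continuousAt hF.continuousAt).fst'
  have hG' : ContinuousAt (fun z : E × V => fderiv ℝ G (F z.1)) (x, ν) :=
    (ContinuousAt.comp' (hG.continuousAt_fderiv one_ne_zero) hF.continuousAt).fst'
  have hG₁ {a b c : E × V → V} (ha : ContinuousAt a (x, ν)) (hb : ContinuousAt b (x, ν))
      (hc : ContinuousAt c (x, ν)) :
      ContinuousAt (fun z : E × V => fderiv ℝ G (F z.1) (a z) (b z) (c z)) (x, ν) :=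
    ((hG'.clm_apply ha).clm_apply hb).clm_apply hc
  have hν : ContinuousAt (Prod.snd : E × V → V) (x, ν) := continuousAt_snd
  exact ((hG₀.clm_apply hF₂).clm_apply hν).add <|
    (((hG₁ (hF₁ X) (hF₁ Y) hν).add (hG₁ (hF₁ Y) (hF₁ X) hν)).sub
      (hG₁ hν (hF₁ X) (hF₁ Y))).div_const 2

lemma eventually_not_isUmbilicalNormal (hG : ContDiffAt ℝ 1 G (F x)) (hF : ContDiffAt ℝ 2 F x)
    (h : ¬ IsUmbilicalNormal G F x ν) :
    ∀ᶠ z in 𝓝 (x, ν), ¬ IsUmbilicalNormal G F z.1 z.2 := by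
  have hF₁ : ContDiffAt ℝ 1 F x := hF.of_le one_le_two
  simp only [IsUmbilicalNormal, not_and_or, not_forall] at h
  rcases h with ⟨X, hX⟩ | ⟨X, Y, Z, W, hne⟩
  · have hG₀ : ContinuousAt (fun z => G (F z)) x :=
      ContinuousAt.comp' hG.continuousAt hF.continuousAt
    have hdF : ContinuousAt (fun z => fderiv ℝ F z X) x :=
      (hF₁.continuousAt_fderiv one_ne_zero).clm_apply continuousAt_const
    have hcont : ContinuousAt (fun z : E × V => G (F z.1) (fderiv ℝ F z.1 X) z.2) (x, ν) :=
      (hG₀.clm_apply hdF).fst'.clm_apply continuousAt_snd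
    filter_upwards [hcont.eventually_ne hX] with z hz hz' using hz (hz'.1 X)
  · have hI (X Y : E) :
        ContinuousAt (fun z : E × V => firstFundamentalForm G F z.1 X Y) (x, ν) :=
      (continuousAt_firstFundamentalForm hG.continuousAt hF₁ X Y).fst'
    have hII := continuousAt_secondFundamentalForm hG hF ν
    have hcont := ((hII X Y).mul (hI Z W)).sub ((hII Z W).mul (hI X Y))
    filter_upwards [hcont.eventually_ne (sub_ne_zero.2 hne)] with z hz hz'
      using hz (sub_eq_zero.2 (hz'.2 X Y Z W))

theorem eventually_forall_isUmbilicalNormal_eq_zero [FiniteDimensional ℝ V]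
    (hG : ContDiffAt ℝ 1 G (F x)) (hF : ContDiffAt ℝ 2 F x)
    (h : ∀ ν, IsUmbilicalNormal G F x ν → ν = 0) :
    ∀ᶠ z in 𝓝 x, ∀ ν, IsUmbilicalNormal G F z ν → ν = 0 := by
  have hsphere : ∀ᶠ z in 𝓝 x, ∀ ν ∈ Metric.sphere (0 : V) 1, ¬ IsUmbilicalNormal G F z ν :=
    (isCompact_sphere 0 1).eventually_forall_of_forall_eventually fun ν hν =>
      eventually_not_isUmbilicalNormal hG hF fun hν' =>
        ne_zero_of_mem_unit_sphere ⟨ν, hν⟩ (h ν hν')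
  filter_upwards [hsphere] with z hz ν hν
  by_contra hν0
  exact hz (‖ν‖⁻¹ • ν) (by simp [norm_smul, hν0]) (hν.smul _)

lemma IsUmbilicalNormal.apply_fderiv_fderiv_eq_zero (h : IsUmbilicalNormal G F x ν)
    (hpos : ∀ a, a ≠ 0 → 0 < G (F x) a a) (hF : fderiv ℝ F x ≠ 0) {v : E}
    (hv : fderiv ℝ F x v = 0) (X : E) : G (F x) (fderiv ℝ (fderiv ℝ F) x X v) ν = 0 := by
  obtain ⟨u, hu⟩ : ∃ u, fderiv ℝ F x u ≠ 0 := by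
    simpa [ContinuousLinearMap.ext_iff] using hF
  have hI : firstFundamentalForm G F x X v = 0 := by simp [firstFundamentalForm, hv]
  have hII : secondFundamentalForm G F x ν X v = 0 := by
    have hprop := h.2 X v u u
    rw [hI, mul_zero] at hprop
    exact (mul_eq_zero.1 hprop).resolve_right (hpos _ hu).ne'
  simpa [secondFundamentalForm, christoffelForm, hv] using hII

/-- When `E` is the plane and `V` is 3-space, `hF`, `hv` and `hspan` are Whitney's criterion for a
cross cap. -/
theorem IsUmbilicalNormal.eq_zero_of_exists_add_eq (h : IsUmbilicalNormal G F x ν)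
    (hpos : ∀ a, a ≠ 0 → 0 < G (F x) a a) (hF : fderiv ℝ F x ≠ 0) {v : E}
    (hv : fderiv ℝ F x v = 0)
    (hspan : ∀ a, ∃ X Y, fderiv ℝ F x X + fderiv ℝ (fderiv ℝ F) x Y v = a) : ν = 0 := by
  by_contra hν
  obtain ⟨X, Y, hXY⟩ := hspan ν
  refine (hpos ν hν).ne' ?_
  nth_rewrite 1 [← hXY]
  rw [map_add, add_apply, h.1, h.apply_fderiv_fderiv_eq_zero hpos hF hv, add_zero]

end Hypersurface

section Standard

lemma contDiff_std {n : WithTop ℕ∞} : ContDiff ℝ n std := by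
  refine contDiff_euclidean.2 fun i => ?_
  fin_cases i <;> dsimp [std] <;> fun_prop

lemma std_zero : std 0 = 0 := by
  ext i
  fin_cases i <;> simp [std]

lemma fderiv_euclidean_apply {E ι : Type*} [NormedAddCommGroup E] [NormedSpace ℝ E] [Finite ι]
    {F : E → EuclideanSpace ℝ ι} {x : E} (hF : DifferentiableAt ℝ F x) (X : E) (i : ι) :
    fderiv ℝ F x X i = fderiv ℝ (fun z => F z i) x X := by
  cases nonempty_fintype ι
  have hcomp := (EuclideanSpace.proj (𝕜 := ℝ) i).hasFDerivAt.comp x hF.hasFDerivAt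
  exact (DFunLike.congr_fun hcomp.fderiv X).symm

lemma fderiv_std_apply (x X : E2) :
    fderiv ℝ std x X = !₂[X 0, x 0 * X 1 + x 1 * X 0, 2 * x 1 * X 1] := by
  have hcoord (i : Fin 2) := PiLp.hasFDerivAt_apply (𝕜 := ℝ) 2 x i
  ext i
  rw [fderiv_euclidean_apply (contDiff_std.differentiable one_ne_zero x)]
  fin_cases i
  · simpa [std] using DFunLike.congr_fun (hcoord 0).fderiv X
  · simpa [std] using DFunLike.congr_fun ((hcoord 0).fun_mul (hcoord 1)).fderiv X
  · simpa [std] using DFunLike.congr_fun ((hcoord 1).pow 2).fderiv X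

lemma fderiv_fderiv_std_apply (x X Y : E2) :
    fderiv ℝ (fderiv ℝ std) x X Y = !₂[0, X 0 * Y 1 + X 1 * Y 0, 2 * X 1 * Y 1] := by
  have hcoord (i : Fin 2) := PiLp.hasFDerivAt_apply (𝕜 := ℝ) 2 x i
  have hd : DifferentiableAt ℝ (fderiv ℝ std) x :=
    (contDiff_std.fderiv_right (m := 1) le_rfl).differentiable one_ne_zero x
  have hswap : fderiv ℝ (fderiv ℝ std) x X Y = fderiv ℝ (fun z => fderiv ℝ std z Y) x X := by
    simp [fderiv_clm_apply hd (differentiableAt_const Y)]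
  ext i
  rw [hswap, fderiv_euclidean_apply (hd.clm_apply (differentiableAt_const Y))]
  simp only [fderiv_std_apply]
  fin_cases i
  · simp
  · simpa [mul_comm] using DFunLike.congr_fun
      (((hcoord 0).mul_const (Y 1)).fun_add ((hcoord 1).mul_const (Y 0))).fderiv X
  · simpa [mul_comm, mul_left_comm] using DFunLike.congr_fun
      (((hcoord 1).const_mul 2).mul_const (Y 1)).fderiv X

theorem IsUmbilicalNormal.eq_zero_of_std {G : E3 → E3 →L[ℝ] E3 →L[ℝ] ℝ} {ν : E3}
    (h : IsUmbilicalNormal G std 0 ν) (hpos : ∀ a, a ≠ 0 → 0 < G (std 0) a a) : ν = 0 := by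
  refine h.eq_zero_of_exists_add_eq hpos (v := !₂[0, 1]) (fun h0 => ?_) ?_ fun a =>
    ⟨!₂[a 0, 0], !₂[a 1, a 2 / 2], ?_⟩
  · simpa [fderiv_std_apply] using congrArg (fun L => L !₂[1, 0] 0) h0
  · ext i
    fin_cases i <;> simp [fderiv_std_apply]
  · ext i
    fin_cases i <;> simp [fderiv_std_apply, fderiv_fderiv_std_apply]
    ring

end Standard

lemma localMap_eventuallyEq {M N : Type*} [TopologicalSpace M] [TopologicalSpace N]
    {φ : OpenPartialHomeomorph M E2} {ψ : OpenPartialHomeomorph N E3} {f : M → N} {p : M}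
    {F : E2 → E3} (hp : p ∈ φ.source) (h : ∀ᶠ q in 𝓝 p, ψ (f q) = F (φ q)) :
    localMap φ ψ f =ᶠ[𝓝 (φ p)] F := by
  have hφ : Filter.Tendsto φ.symm (𝓝 (φ p)) (𝓝 p) := by
    simpa only [φ.left_inv hp] using (φ.continuousAt_symm (φ.map_source hp)).tendsto
  filter_upwards [hφ.eventually h, φ.open_target.mem_nhds (φ.map_source hp)] with x hx hxt
  rw [localMap, hx, φ.right_inv hxt]

section Charts

variable {M : Type*} [TopologicalSpace M] [ChartedSpace E2 M]
  {N : Type*} [TopologicalSpace N] [ChartedSpace E3 N] [IsManifold (𝓡 3) ∞ N]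
  {g : Metric N} {φ : OpenPartialHomeomorph M E2} {ψ : OpenPartialHomeomorph N E3} {f : M → N}

/-- The metric `g` in the coordinates `ψ`, as a field of continuous bilinear forms. -/
def metricField (g : Metric N) (ψ : OpenPartialHomeomorph N E3) (y : E3) :
    E3 →L[ℝ] E3 →L[ℝ] ℝ :=
  let B : E3 →L[ℝ] E3 →L[ℝ] ℝ := g.inner (ψ.symm y)
  let A : E3 →L[ℝ] E3 := mfderiv (𝓡 3) (𝓡 3) ψ.symm y
  B.bilinearComp A A

lemma metricField_apply (g : Metric N) (ψ : OpenPartialHomeomorph N E3) (y a b : E3) :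
    metricField g ψ y a b = localMetric g ψ y a b := rfl

lemma contMDiffOn_coordVectorField (hψ : ψ ∈ IsManifold.maximalAtlas (𝓡 3) ∞ N) (a : E3) :
    ContMDiffOn (𝓡 3) (𝓡 3).tangent ∞
      (fun y => (⟨ψ.symm y, mfderiv (𝓡 3) (𝓡 3) ψ.symm y a⟩ : TangentBundle (𝓡 3) N))
      ψ.target := by
  have : IsManifold (𝓡 3) 1 N := IsManifold.of_le (n := ∞) (by norm_cast)
  have hT := (contMDiffOn_symm_of_mem_maximalAtlas hψ).contMDiffOn_tangentMapWithin (m := ∞)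
    (by norm_cast) ψ.open_target.uniqueMDiffOn
  have ha : ContMDiffOn (𝓡 3) (𝓡 3).tangent ∞
      (fun y => (⟨y, a⟩ : TangentBundle (𝓡 3) E3)) ψ.target :=
    contMDiffOn_vectorSpace_iff_contDiffOn.2 contDiffOn_const
  refine (hT.comp ha fun y hy => hy).congr fun y hy => ?_
  simp [tangentMapWithin, mfderivWithin_of_isOpen ψ.open_target hy]

lemma contDiffOn_metricField (g : Metric N) (hψ : ψ ∈ IsManifold.maximalAtlas (𝓡 3) ∞ N) :
    ContDiffOn ℝ ∞ (metricField g ψ) ψ.target := by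
  refine contDiffOn_clm_apply.2 fun a => contDiffOn_clm_apply.2 fun b y hy => ?_
  have hψy := contMDiffOn_symm_of_mem_maximalAtlas hψ y hy
  have hg : ContMDiffWithinAt (𝓡 3) ((𝓡 3).prod 𝓘(ℝ)) ∞
      (fun y ↦ Bundle.TotalSpace.mk' ℝ (E := Bundle.Trivial N ℝ) (ψ.symm y)
        (localMetric g ψ y a b)) ψ.target y :=
    ContMDiffWithinAt.clm_bundle_apply₂ (F₁ := E3) (F₂ := E3)
      (g.contMDiff.contMDiffAt.comp_contMDiffWithinAt y hψy)
      (contMDiffOn_coordVectorField hψ a y hy) (contMDiffOn_coordVectorField hψ b y hy)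
  exact (Bundle.contMDiffWithinAt_totalSpace.1 hg).2.contDiffWithinAt

lemma metricField_self_pos (g : Metric N) (hψ : ψ ∈ IsManifold.maximalAtlas (𝓡 3) ∞ N) {y : E3}
    (hy : y ∈ ψ.target) {a : E3} (ha : a ≠ 0) : 0 < metricField g ψ y a a := by
  have hd : ψ.MDifferentiable (𝓡 3) (𝓡 3) :=
    ⟨(contMDiffOn_of_mem_maximalAtlas hψ).mdifferentiableOn (by simp),
      (contMDiffOn_symm_of_mem_maximalAtlas hψ).mdifferentiableOn (by simp)⟩
  exact g.pos _ _ fun h => ha (hd.symm.mfderiv_injective hy (h.trans (map_zero _).symm))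

lemma christoffel_eq_christoffelForm {y : E3} (h : DifferentiableAt ℝ (metricField g ψ) y)
    (a b c : E3) : christoffel g ψ y a b c = christoffelForm (metricField g ψ) y a b c := by
  have hderiv (a b c : E3) : fderiv ℝ (fun z => localMetric g ψ z b c) y a =
      fderiv ℝ (metricField g ψ) y a b c := by
    have hbc := (h.hasFDerivAt.clm_apply (hasFDerivAt_const b y)).clm_apply
      (hasFDerivAt_const c y)
    simpa [metricField_apply] using DFunLike.congr_fun hbc.fderiv a
  simp only [christoffel, christoffelForm, hderiv]

lemma IsUmbilicalPoint.exists_isUmbilicalNormal {q : M} (h : IsUmbilicalPoint g f q)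
    (hφ : φ ∈ IsManifold.maximalAtlas (𝓡 2) ∞ M) (hψ : ψ ∈ IsManifold.maximalAtlas (𝓡 3) ∞ N)
    (hq : q ∈ φ.source) (hfq : f q ∈ ψ.source) :
    ∃ ν ≠ 0, IsUmbilicalNormal (metricField g ψ) (localMap φ ψ f) (φ q) ν := by
  obtain ⟨ν, ⟨hunit, hnormal⟩, c, hc⟩ := h.2 φ hφ ψ hψ hq hfq
  have hmem : localMap φ ψ f (φ q) ∈ ψ.target := by
    simpa only [localMap, φ.left_inv hq] using ψ.map_source hfq
  have hd : DifferentiableAt ℝ (metricField g ψ) (localMap φ ψ f (φ q)) :=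
    ((contDiffOn_metricField g hψ).contDiffAt (ψ.open_target.mem_nhds hmem)).differentiableAt
      (by simp)
  have hII (X Y : E2) : secondFundamentalForm (metricField g ψ) (localMap φ ψ f) (φ q) ν X Y =
      c * firstFundamentalForm (metricField g ψ) (localMap φ ψ f) (φ q) X Y := by
    rw [secondFundamentalForm, ← christoffel_eq_christoffelForm hd]
    exact hc X Y
  refine ⟨ν, ?_, hnormal, fun X Y Z W => by rw [hII, hII]; ring⟩
  rintro rfl
  rw [← metricField_apply, map_zero] at hunit
  exact zero_ne_one hunit

end Charts

end CrossCap

end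

open CrossCap in
theorem mainTheorem7_general {M : Type*} [TopologicalSpace M] [ChartedSpace E2 M]
    {N : Type*} [TopologicalSpace N] [ChartedSpace E3 N] [IsManifold (𝓡 3) ∞ N]
    (g : Metric N) {f : M → N} {p : M} (hf : ContinuousAt f p)
    (hp : IsCrossCapAt f p) : ∀ᶠ q in 𝓝 p, ¬ IsUmbilicalPoint g f q := by
  obtain ⟨φ, hφ, ψ, hψ, hpφ, hφp, hpψ, hψp, hstd⟩ := hp
  have hF : localMap φ ψ f =ᶠ[𝓝 0] std := hφp ▸ localMap_eventuallyEq hpφ hstd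
  have h0 : std 0 ∈ ψ.target := by
    rw [std_zero, ← hψp]
    exact ψ.map_source hpψ
  have hG : ContDiffAt ℝ ∞ (metricField g ψ) (std 0) :=
    (contDiffOn_metricField g hψ).contDiffAt (ψ.open_target.mem_nhds h0)
  have hnear := eventually_forall_isUmbilicalNormal_eq_zero (hG.of_le (by norm_cast))
    contDiff_std.contDiffAt fun ν hν =>
      hν.eq_zero_of_std fun _ => metricField_self_pos g hψ h0
  have hφt : Filter.Tendsto φ (𝓝 p) (𝓝 0) := hφp ▸ φ.continuousAt hpφ
  filter_upwards [φ.open_source.mem_nhds hpφ, hf (ψ.open_source.mem_nhds hpψ),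
    hφt.eventually hnear, hφt.eventually hF.eventuallyEq_nhds] with q hqφ hqψ hq hFq humb
  obtain ⟨ν, hν0, hν⟩ := humb.exists_isUmbilicalNormal hφ hψ hqφ hqψ
  exact hν0 (hq ν ((isUmbilicalNormal_congr hFq).1 hν))

theorem mainTheorem7
    {M : Type*} [TopologicalSpace M] [ChartedSpace (EuclideanSpace ℝ (Fin 2)) M]
    [IsManifold (𝓡 2) ∞ M]
    {N : Type*} [TopologicalSpace N] [ChartedSpace (EuclideanSpace ℝ (Fin 3)) N]
    [IsManifold (𝓡 3) ∞ N]
    (g : CrossCap.Metric N) (f : M → N) (hf : ContMDiff (𝓡 2) (𝓡 3) ∞ f)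
    (p : M) (hp : CrossCap.IsCrossCapAt f p) :
    ¬ AccPt p (Filter.principal {q : M | CrossCap.IsUmbilicalPoint g f q}) := by
  rw [accPt_iff_frequently, Filter.not_frequently]
  exact (mainTheorem7_general g hf.continuous.continuousAt hp).mono fun q hq h => hq h.2
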